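/- Let $m\ge 5$ be odd, let $u\ge 1$ be an integer with $\gcd(u,m)=1$, and let $\rho\in\mathbb{F}_2$ be such that either $\frac{m^2-1}{8}$ is even and $\rho=1$, or $\frac{m^2-1}{8}$ is odd and $\rho=0$. Let $\mathrm{Tr}$ be the absolute trace from $\mathbb{F}_{2^m}$ to $\mathbb{F}_2$, and let $$D_\rho=\{x\in\mathbb{F}_{2^m} : \mathrm{Tr}(x)=1,\ \mathrm{Tr}(x^{2^u+1})=\rho\}=\{d_1,\dots,d_n\}$$ with $d_1,\dots,d_n$ distinct. Let $\mathcal{C}_{D_\rho}=\{(\mathrm{Tr}(bd_1),\dots,\mathrm{Tr}(bd_n)) : b\in\mathbb{F}_{2^m}\}$, and let $\mathcal{C}_{D_\rho}^{\perp}$ be its dual with respect to the Euclidean inner product. For a code $\mathcal{C}\subseteq\mathbb{F}_2^n$ let $A_w(\mathcal{C})$ be the number of codewords of Hamming weight $w$. The codewords of weight $w$ in $\mathcal{C}$ hold a $2$-$(v,w,\lambda)$ design if $n=v\ge w\ge 2$, $\lambda\ge 1$, and every $2$-subset of the set $\{1,\dots,n\}$ is contained in exactly $\lambda$ of the sets that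 are supports of codewords of weight $w$ in $\mathcal{C}$. Put $N=2^{m-2}+2^{\frac{m-3}{2}}$. Then the following two assertions hold. (1) The codewords of weight $2^{m-3}$ in $\mathcal{C}_{D_\rho}$ hold a $2$-$\bigl(N,\,2^{m-3},\,2^{m-3}-2^{\frac{m-3}{2}}\bigr)$ design, and the codewords of weight $2^{m-3}+2^{\frac{m-3}{2}}$ in $\mathcal{C}_{D_\rho}$ hold a $2$-$\bigl(N,\,2^{m-3}+2^{\frac{m-3}{2}},\,2^{m-3}+2^{\frac{m-3}{2}}-1\bigr)$ design. (2) For every $r=2,3,\dots,2^{m-3}+2^{\frac{m-5}{2}}$, $$A_{2r}(\mathcal{C}_{D_\rho}^{\perp})=2^{-(m-1)}\Biggl(\binom{N}{2r}+(2^{m-1}-1)\sum_{\substack{0\le i\le 2^{m-3}\\ 0\le j\le 2^{(m-5)/2}\\ i+j=r}}(-1)^i\binom{2^{m-3}}{i}\binom{2^{\frac{m-3}{2}}}{2j}\Biggr),$$ and if $A_{2r}(\mathcal{C}_{D_\rho}^{\perp})>0$, then the codewords of weight $2r$ in $\mathcal{C}_{D_\rho}^{\perp}$ hold a $2$-$\Bigl(N,\,2r,\,\frac{2r(2r-1)A_{2r}(\mathcal{C}_{D_\rho}^{\perp})}{N(N-1)}\Bigr)$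 design. (For $2r=N$ this is the trivial design with one block.) -/

import Mathlib

/-- `IsDesign B t v k l`: the points of `P` and the set of blocks `B` form a (simple)
`t`-`(v, k, l)` design, i.e. there are `v` points, every block has `k` points, and every set of
`t` points is contained in exactly `l` blocks. -/
structure IsDesign {P : Type*} [Fintype P] (B : Set (Finset P)) (t v k l : ℕ) : Prop where
  one_le_t : 1 ≤ t
  t_le_k : t ≤ k
  k_le_v : k ≤ v
  l_pos : 0 < l
  card_points : Fintype.card P = v
  card_block : ∀ b ∈ B, b.card = k
  card_blocks_containing : ∀ T : Finset P, T.card = t → {b ∈ B | T ⊆ b}.ncard = l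

/-- The support of a word: the set of coordinates where it does not vanish. -/
def wordSupport {K ι : Type*} [Field K] [DecidableEq K] [Fintype ι] (c : ι → K) : Finset ι :=
  Finset.univ.filter (fun i => c i ≠ 0)

/-- The number `A_w(C)` of codewords of Hamming weight `w` in the linear code `C`. -/
noncomputable def weightCount {K ι : Type*} [Field K] [DecidableEq K] [Fintype ι]
    (C : Submodule K (ι → K)) (w : ℕ) : ℕ :=
  {c : ι → K | c ∈ C ∧ hammingNorm c = w}.ncard

/-- The set of supports of the codewords of Hamming weight `w` in the linear code `C`. -/
def supportBlocks {K ι : Type*} [Field K] [DecidableEq K] [Fintype ι]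
    (C : Submodule K (ι → K)) (w : ℕ) : Set (Finset ι) :=
  {b | ∃ c ∈ C, hammingNorm c = w ∧ wordSupport c = b}

/-- The codewords of Hamming weight `w` in `C` hold a `t`-`(v, w, l)` design. -/
def HoldsDesign {K ι : Type*} [Field K] [DecidableEq K] [Fintype ι]
    (C : Submodule K (ι → K)) (t v w l : ℕ) : Prop :=
  IsDesign (supportBlocks C w) t v w l

/-- The dual code with respect to the Euclidean inner product. -/
def dualCode {K ι : Type*} [Field K] [Fintype ι] (C : Submodule K (ι → K)) :
    Submodule K (ι → K) where
  carrier := {c' | ∀ c ∈ C, ∑ i, c' i * c i = 0}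
  zero_mem' := by
    intro c _
    simp
  add_mem' := by
    intro a b ha hb c hc
    simp [add_mul, Finset.sum_add_distrib, ha c hc, hb c hc]
  smul_mem' := by
    intro r a ha c hc
    simp [mul_assoc, ← Finset.mul_sum, ha c hc]

/-- The binary code `{(Tr(b d₁), …, Tr(b dₙ)) | b ∈ F}` attached to `d₁, …, dₙ ∈ F`, where `Tr`
is the absolute trace. -/
noncomputable def traceCode {F ι : Type*} [Field F] [Algebra (ZMod 2) F] (d : ι → F) :
    Submodule (ZMod 2) (ι → ZMod 2) where
  carrier := {c | ∃ b : F, c = fun i => Algebra.trace (ZMod 2) F (b * d i)}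
  zero_mem' := by
    refine ⟨0, ?_⟩
    funext i
    simp
  add_mem' := by
    rintro _ _ ⟨a, rfl⟩ ⟨b, rfl⟩
    refine ⟨a + b, ?_⟩
    funext i
    simp [add_mul]
  smul_mem' := by
    rintro r _ ⟨b, rfl⟩
    refine ⟨r • b, ?_⟩
    funext i
    simp

/-- The defining set `{x ∈ F | Tr(x) = 1, Tr(x^(2^u + 1)) = ρ}`. -/
def definingSet (F : Type*) [Field F] [Algebra (ZMod 2) F] (u : ℕ) (ρ : ZMod 2) : Set F :=
  {x | Algebra.trace (ZMod 2) F x = 1 ∧ Algebra.trace (ZMod 2) F (x ^ (2 ^ u + 1)) = ρ}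

/-! Write χ(x) = (-1)^Tr(x) and q = 2^((m-3)/2), so that |F| = 8q². The Walsh sum W(b) = Σ
χ(x^(2^u+1) + bx) satisfies W(b)² = 2^m (1 + χ(1+b)) (`goldSum_sq`): it vanishes when Tr b = 0 and
is ±4q when Tr b = 1. Expanding the indicator of the defining set D in characters expresses 4
Σ_{x∈D} χ(bx) through W(b) - W(b+1). As Tr 1 = 1, exactly one of these two terms is nonzero, so the
sum over D is ±q for every b ≠ 0, 1.

At b = 0 the size of D requires the sign of W(1), which is the Jacobi symbol (2/m) (`goldSum_one`).
It is found by induction on m: an automorphism of prime order p dividing m gives a congruence modulo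
p between the sums for F and for its fixed field. The condition on ρ makes |D| = 2q² + q. The
nonconstant codewords thus have weights q² and q² + q, and b = 1 gives the all-one word.

The designs follow from `IsTwoWeightSet` alone. The d_i are distinct and have trace 1, so no one,
two or three of them with distinct indices sum to zero. Hence the sums of χ(b d_i) and χ(b(d_i +
d_j)) over the b of a given weight do not depend on the indices, and neither does the distribution
of |T ∩ supp b| for a pair T (`four_mul_sum_sumClass`). This is the design property of the code. For
the dual, a MacWilliams-type expansion writes the number of words of weight k whose support contains
T in terms of wt(b) and |T ∩ supp b| only (`card_field_mul_card_zeroSumSets`). With T a pair it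
gives the designs, with T empty the weight formula. -/

/-- The nontrivial additive character of `ZMod 2`, with values in `ℤ`. -/
def sgn (a : ZMod 2) : ℤ := if a = 0 then 1 else -1

theorem sgn_zero : sgn 0 = 1 := rfl

theorem sgn_one : sgn 1 = -1 := rfl

theorem sgn_add (a b : ZMod 2) : sgn (a + b) = sgn a * sgn b := by
  revert a b; decide

theorem sgn_eq_one_or (a : ZMod 2) : sgn a = 1 ∨ sgn a = -1 := by
  revert a; decide

theorem sgn_eq_one_iff (a : ZMod 2) : sgn a = 1 ↔ a = 0 := by
  revert a; decide

/-! ### The trace character and the Walsh spectrum of the Gold form. -/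

section TraceSign

variable {F : Type*} [Field F] [Algebra (ZMod 2) F]

/-- The canonical additive character of a field of characteristic two. -/
noncomputable def traceSign (x : F) : ℤ := sgn (Algebra.trace (ZMod 2) F x)

theorem traceSign_add (x y : F) : traceSign (x + y) = traceSign x * traceSign y := by
  simp [traceSign, sgn_add]

theorem traceSign_zero : traceSign (0 : F) = 1 := by
  simp [traceSign, sgn_zero]

theorem traceSign_eq_one_or (x : F) : traceSign x = 1 ∨ traceSign x = -1 := sgn_eq_one_or _

theorem traceSign_mul_self (x : F) : traceSign x * traceSign x = 1 := by
  rcases traceSign_eq_one_or x with h | h <;> simp [h]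

theorem traceSign_sum {ι : Type*} (s : Finset ι) (f : ι → F) :
    traceSign (∑ i ∈ s, f i) = ∏ i ∈ s, traceSign (f i) := by
  classical
  induction s using Finset.induction_on with
  | empty => simp [traceSign_zero]
  | insert a s ha ih => rw [Finset.sum_insert ha, Finset.prod_insert ha, traceSign_add, ih]

variable (F) in
theorem charP_two_of_algebra : CharP F 2 :=
  charP_of_injective_algebraMap (algebraMap (ZMod 2) F).injective 2

theorem exists_traceSign_mul_eq_neg_one [Finite F] {b : F} (hb : b ≠ 0) :
    ∃ y : F, traceSign (b * y) = -1 := by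
  have h := (traceForm_nondegenerate (ZMod 2) F).1 b
  by_contra! hc
  refine hb (h fun y => ?_)
  have := (traceSign_eq_one_or (b * y)).resolve_right (hc y)
  simpa [Algebra.traceForm_apply] using (sgn_eq_one_iff _).1 this

theorem sum_traceSign_mul [Fintype F] [DecidableEq F] (b : F) :
    ∑ x : F, traceSign (b * x) = if b = 0 then (Fintype.card F : ℤ) else 0 := by
  split_ifs with hb
  · simp [hb, traceSign_zero]
  · obtain ⟨y, hy⟩ := exists_traceSign_mul_eq_neg_one hb
    have h := Equiv.sum_comp (Equiv.addRight y) fun x : F => traceSign (b * x)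
    simp only [Equiv.coe_addRight, mul_add, traceSign_add, hy, mul_neg, mul_one,
      Finset.sum_neg_distrib] at h
    linarith

theorem traceSign_sq [Finite F] (x : F) : traceSign (x ^ 2) = traceSign x := by
  have := Algebra.trace_eq_of_algEquiv
    (FiniteField.frobeniusAlgEquivOfAlgebraic (ZMod 2) F) x
  simp only [FiniteField.coe_frobeniusAlgEquivOfAlgebraic, ZMod.card] at this
  simp [traceSign, this]

theorem traceSign_pow_two_pow [Finite F] (x : F) (u : ℕ) :
    traceSign (x ^ 2 ^ u) = traceSign x := by
  induction u with
  | zero => simp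
  | succ u ih => rw [pow_succ, pow_mul, traceSign_sq, ih]

theorem pow_two_pow_injective [Finite F] (u : ℕ) :
    Function.Injective fun x : F => x ^ 2 ^ u := by
  have := charP_two_of_algebra F
  intro x y h
  have : (x - y) ^ 2 ^ u = 0 := by
    rw [sub_pow_char_pow, sub_eq_zero]; exact h
  exact sub_eq_zero.1 (pow_eq_zero_iff (by positivity) |>.1 this)

/-- The Walsh transform of the quadratic form `x ↦ Tr (x ^ (2 ^ u + 1))`. -/
noncomputable def goldSum (F : Type*) [Field F] [Algebra (ZMod 2) F] [Fintype F] (u : ℕ)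
    (b : F) : ℤ :=
  ∑ x : F, traceSign (x ^ (2 ^ u + 1) + b * x)

/-- Polarization: the cross terms are z x^(2^u) + z^(2^u) x. Raising the second one to the power 2^u
keeps its trace and makes both linear in x^(2^u). -/
theorem traceSign_gold_mul [Finite F] (u : ℕ) (b x z : F) :
    traceSign (x ^ (2 ^ u + 1) + b * x) *
        traceSign ((x + z) ^ (2 ^ u + 1) + b * (x + z)) =
      traceSign (z ^ (2 ^ u + 1) + b * z) *
        traceSign ((z + z ^ 2 ^ (2 * u)) * x ^ 2 ^ u) := by
  have := charP_two_of_algebra F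
  have h1 : (x + z) ^ (2 ^ u + 1) + b * (x + z) = (x ^ (2 ^ u + 1) + b * x) +
      (z ^ (2 ^ u + 1) + b * z) + (z * x ^ 2 ^ u + z ^ 2 ^ u * x) := by
    rw [pow_succ, add_pow_char_pow]; ring
  have h2 : z ^ 2 ^ (2 * u) * x ^ 2 ^ u = (z ^ 2 ^ u * x) ^ 2 ^ u := by
    rw [mul_pow, ← pow_mul, ← pow_add, two_mul]
  rw [h1, add_mul, h2]
  generalize x ^ (2 ^ u + 1) + b * x = A
  generalize z ^ (2 ^ u + 1) + b * z = B
  simp only [traceSign_add, traceSign_pow_two_pow]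
  linear_combination (traceSign B * traceSign (z * x ^ 2 ^ u) * traceSign (z ^ 2 ^ u * x)) *
    traceSign_mul_self A

theorem goldSum_sq_eq [Fintype F] [DecidableEq F] (u : ℕ) (b : F) :
    goldSum F u b ^ 2 = ∑ z : F, traceSign (z ^ (2 ^ u + 1) + b * z) *
      (if z + z ^ 2 ^ (2 * u) = 0 then (Fintype.card F : ℤ) else 0) := by
  have h (x : F) : ∑ y : F, traceSign (x ^ (2 ^ u + 1) + b * x) *
      traceSign (y ^ (2 ^ u + 1) + b * y) = ∑ z : F, traceSign (z ^ (2 ^ u + 1) + b * z) *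
        traceSign ((z + z ^ 2 ^ (2 * u)) * x ^ 2 ^ u) := by
    rw [← Equiv.sum_comp (Equiv.addLeft x)]
    exact Finset.sum_congr rfl fun z _ => traceSign_gold_mul u b x z
  rw [sq, goldSum, Finset.sum_mul_sum, Finset.sum_congr rfl fun x _ => h x, Finset.sum_comm]
  refine Finset.sum_congr rfl fun z _ => ?_
  rw [← Finset.mul_sum, ← sum_traceSign_mul]
  congr 1
  -- Since x ↦ x^(2^u) permutes F, the inner sum is a full sum of an additive character.
  exact Equiv.sum_comp (Equiv.ofBijective _ (Finite.injective_iff_bijective.1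
    (pow_two_pow_injective (F := F) u))) fun x => traceSign ((z + z ^ 2 ^ (2 * u)) * x)

/-- The radical of the form: z is fixed by the Frobenius iterates of orders 2u and m, hence by the
iterate of order gcd(2u, m) = 1, so z² = z. -/
theorem add_pow_eq_zero_iff [Finite F] {m u : ℕ} (hF : Nat.card F = 2 ^ m) (hm : Odd m)
    (hum : Nat.Coprime u m) (z : F) : z + z ^ 2 ^ (2 * u) = 0 ↔ z = 0 ∨ z = 1 := by
  have := charP_two_of_algebra F
  have : Fintype F := Fintype.ofFinite F
  constructor
  · intro h
    have hz : z ^ 2 ^ (2 * u) = z := (CharTwo.add_eq_zero.1 h).symm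
    have key (n : ℕ) : Function.IsPeriodicPt (fun x : F => x ^ 2) n z ↔ z ^ 2 ^ n = z := by
      rw [Function.IsPeriodicPt, Function.IsFixedPt, pow_iterate]
    have hm' : z ^ 2 ^ m = z := by
      rw [← hF, Nat.card_eq_fintype_card]; exact FiniteField.pow_card z
    have hg : Nat.gcd (2 * u) m = 1 :=
      Nat.Coprime.mul_left (Nat.coprime_two_left.2 hm) hum
    have h1 := ((key _).2 hz).gcd ((key _).2 hm')
    rw [hg, key, pow_one] at h1
    have h2 : z * (z - 1) = 0 := by linear_combination h1
    rcases mul_eq_zero.1 h2 with h | h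
    · exact Or.inl h
    · exact Or.inr (sub_eq_zero.1 h)
  · rintro (rfl | rfl)
    · simp
    · simpa using CharTwo.add_self_eq_zero (1 : F)

theorem goldSum_sq [Fintype F] {m u : ℕ} (hF : Nat.card F = 2 ^ m) (hm : Odd m)
    (hum : Nat.Coprime u m) (b : F) :
    goldSum F u b ^ 2 = 2 ^ m * (1 + traceSign (1 + b)) := by
  classical
  have hc : (Fintype.card F : ℤ) = 2 ^ m := by
    rw [← Nat.card_eq_fintype_card, hF]; norm_cast
  rw [goldSum_sq_eq]
  simp_rw [add_pow_eq_zero_iff hF hm hum, mul_ite, mul_zero]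
  rw [← Finset.sum_filter]
  have : (Finset.univ.filter fun z : F => z = 0 ∨ z = 1) = {0, 1} := by
    ext z; simp
  rw [this, Finset.sum_pair zero_ne_one, hc]
  simp [traceSign_zero]
  ring

theorem traceSign_one [Finite F] {m : ℕ} (hF : Nat.card F = 2 ^ m) (hm : Odd m) :
    traceSign (1 : F) = -1 := by
  have h1 : Module.finrank (ZMod 2) F = m := by
    have := Module.natCard_eq_pow_finrank (K := ZMod 2) (V := F)
    rw [hF, Nat.card_zmod] at this
    exact (Nat.pow_right_injective le_rfl this).symm
  have h2 : Algebra.trace (ZMod 2) F 1 = 1 := by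
    rw [← map_one (algebraMap (ZMod 2) F), Algebra.trace_algebraMap, h1, nsmul_eq_mul, mul_one]
    exact ZMod.natCast_eq_one_iff_odd.2 hm
  rw [traceSign, h2, sgn_one]

end TraceSign

/-! ### The sign of the Walsh sum at 1, by counting fixed points modulo a prime. -/

section PermutationCongruence

variable {α : Type*} [Fintype α] [DecidableEq α] {p : ℕ} [Fact p.Prime]

theorem card_filter_fixed_modEq {σ : Equiv.Perm α} (hσ : σ ^ p = 1) (P : α → Prop)
    [DecidablePred P] (hP : ∀ x, P (σ x) ↔ P x) :
    (Finset.univ.filter fun x => P x ∧ σ x = x).card ≡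
      (Finset.univ.filter fun x => P x).card [MOD p] := by
  have hτ : (σ.subtypePerm hP) ^ p ^ 1 = 1 := by
    ext x
    simp [Equiv.Perm.subtypePerm_pow, hσ]
  have h := Equiv.Perm.card_compl_support_modEq hτ
  rw [Fintype.card_subtype] at h
  convert h using 1
  rw [← Finset.card_map (Function.Embedding.subtype P)]
  congr 1
  ext x
  simp [Subtype.ext_iff, and_comm]

/-- Orbits of σ have size 1 or p and f is constant on them. With values ±1, a sum of f is twice the
size of the level set f = 1 minus the number of terms, so counting suffices. -/
theorem sum_fixed_modEq {σ : Equiv.Perm α} (hσ : σ ^ p = 1) (f : α → ℤ)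
    (hf : ∀ x, f (σ x) = f x) (hf1 : ∀ x, f x = 1 ∨ f x = -1) :
    ∑ x ∈ Finset.univ.filter (fun x => σ x = x), f x ≡ ∑ x, f x [ZMOD p] := by
  have hs (s : Finset α) : ∑ x ∈ s, f x = 2 * ((s.filter fun x => f x = 1).card : ℤ) - s.card := by
    rw [Finset.card_filter, Nat.cast_sum, Finset.mul_sum, Finset.card_eq_sum_ones, Nat.cast_sum,
      ← Finset.sum_sub_distrib]
    refine Finset.sum_congr rfl fun x _ => ?_
    rcases hf1 x with h | h <;> simp [h]
  have h1 := card_filter_fixed_modEq hσ (fun x => f x = 1) fun x => by rw [hf]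
  have h2 := card_filter_fixed_modEq hσ (fun _ => True) fun x => by simp
  simp only [true_and, Finset.filter_true] at h2
  rw [hs, hs, Finset.filter_filter]
  simp_rw [and_comm (a := σ _ = _)]
  rw [← Int.natCast_modEq_iff] at h1 h2
  exact (h1.mul_left 2).sub h2

end PermutationCongruence

theorem goldSum_fixedField_modEq {F : Type*} [Field F] [Algebra (ZMod 2) F] [Fintype F] (u : ℕ)
    {p : ℕ} [Fact p.Prime] (hp : p ≠ 2) {g : Gal(F/ZMod 2)} (hg : orderOf g = p)
    [Fintype (IntermediateField.fixedField (Subgroup.zpowers g))] :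
    goldSum (IntermediateField.fixedField (Subgroup.zpowers g)) u 1 ≡ goldSum F u 1 [ZMOD p] := by
  classical
  set E := IntermediateField.fixedField (Subgroup.zpowers g) with hE
  have hfin : Module.finrank E F = p := by
    rw [hE, IntermediateField.finrank_fixedField_eq_card, Nat.card_zpowers, hg]
  have hmem (x : F) : x ∈ E ↔ g x = x := by
    rw [hE, IntermediateField.mem_fixedField_iff]
    refine ⟨fun h => h g (Subgroup.mem_zpowers g), fun h f hf => ?_⟩
    have hst : g ∈ MulAction.stabilizer Gal(F/ZMod 2) x := h
    exact (Subgroup.zpowers_le.2 hst) hf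
  -- On E the trace of F is [F : E] = p times the trace of E, and p is odd.
  have htr (y : E) : traceSign (y : F) = traceSign y := by
    have h1 : Algebra.trace (ZMod 2) F (algebraMap E F y) = Algebra.trace (ZMod 2) E y := by
      rw [← Algebra.trace_trace (S := E), Algebra.trace_algebraMap, hfin, map_nsmul, nsmul_eq_mul]
      have hodd : Odd p := (Fact.out : p.Prime).odd_of_ne_two hp
      rw [(ZMod.natCast_eq_one_iff_odd).2 hodd, one_mul]
    exact congrArg sgn h1
  have hσ : (MulAction.toPermHom Gal(F/ZMod 2) F g) ^ p = 1 := by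
    rw [← map_pow, ← hg, pow_orderOf_eq_one, map_one]
  have h := sum_fixed_modEq hσ (fun x : F => traceSign (x ^ (2 ^ u + 1) + 1 * x))
    (fun x => ?_) fun x => traceSign_eq_one_or _
  -- The congruence unfolds to an equality of remainders, so only the left-hand sums need to be
  -- identified.
  · refine Eq.trans (congrArg (· % (p : ℤ)) ?_) h
    rw [goldSum, Finset.sum_subtype (p := (· ∈ E)) _ fun x => by simp [hmem]]
    exact Finset.sum_congr rfl fun y _ => (htr (y ^ (2 ^ u + 1) + 1 * y)).symm
  · have h1 : g x ^ (2 ^ u + 1) + 1 * g x = g (x ^ (2 ^ u + 1) + 1 * x) := by simp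
    exact (congrArg traceSign h1).trans
      (congrArg sgn (Algebra.trace_eq_of_algEquiv g (x ^ (2 ^ u + 1) + 1 * x)))

theorem exists_goldSum_modEq {F : Type*} [Field F] [Algebra (ZMod 2) F] [Fintype F] (u : ℕ)
    {p m : ℕ} [Fact p.Prime] (hp : p ≠ 2) (hF : Nat.card F = 2 ^ (p * m)) :
    ∃ E : IntermediateField (ZMod 2) F, Nat.card E = 2 ^ m ∧
      ∀ _ : Fintype E, goldSum E u 1 ≡ goldSum F u 1 [ZMOD p] := by
  have h1 : Module.finrank (ZMod 2) F = p * m := by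
    have := Module.natCard_eq_pow_finrank (K := ZMod 2) (V := F)
    rw [hF, Nat.card_zmod] at this
    exact (Nat.pow_right_injective le_rfl this).symm
  have : Fintype Gal(F/ZMod 2) := Fintype.ofFinite _
  have h2 := IsGalois.card_aut_eq_finrank (ZMod 2) F
  obtain ⟨g, hg⟩ := exists_prime_orderOf_dvd_card (G := Gal(F/ZMod 2)) p
    (by rw [← Nat.card_eq_fintype_card, h2, h1]; exact dvd_mul_right _ _)
  refine ⟨IntermediateField.fixedField (Subgroup.zpowers g), ?_, fun _ =>
    goldSum_fixedField_modEq u hp hg⟩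
  have h3 := Module.finrank_mul_finrank (ZMod 2)
    (IntermediateField.fixedField (Subgroup.zpowers g)) F
  rw [IntermediateField.finrank_fixedField_eq_card, Nat.card_zpowers, hg, h1, mul_comm] at h3
  rw [Module.natCard_eq_pow_finrank (K := ZMod 2), Nat.card_zmod,
    Nat.eq_of_mul_eq_mul_left (Fact.out : p.Prime).pos h3]

theorem traceSign_one_add_one {F : Type*} [Field F] [Algebra (ZMod 2) F] :
    traceSign (1 + 1 : F) = 1 := by
  rw [traceSign_add, traceSign_mul_self]

theorem goldSum_one_eq_or {F : Type*} [Field F] [Algebra (ZMod 2) F] [Fintype F]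
    {m u : ℕ} (hF : Nat.card F = 2 ^ m) (hm : Odd m) (hum : Nat.Coprime u m) :
    goldSum F u 1 = 2 ^ ((m + 1) / 2) ∨ goldSum F u 1 = -2 ^ ((m + 1) / 2) := by
  rw [← sq_eq_sq_iff_eq_or_eq_neg, goldSum_sq hF hm hum, traceSign_one_add_one, ← pow_mul,
    Nat.div_mul_cancel (hm.add_one).two_dvd]
  ring

theorem sign_eq_of_modEq {p : ℕ} (hp : 2 < p) {a b : ℤ} (ha : a = 1 ∨ a = -1)
    (hb : b = 1 ∨ b = -1) (h : (a : ZMod p) = b) : a = b := by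
  have h1 := (ZMod.intCast_eq_intCast_iff_dvd_sub _ _ _).1 h
  rcases ha with rfl | rfl <;> rcases hb with rfl | rfl
  · rfl
  · have := Int.le_of_dvd (by norm_num) (dvd_neg.2 h1)
    norm_num at this; omega
  · have := Int.le_of_dvd (by norm_num) h1
    norm_num at this; omega
  · rfl

/-- Induction through m = pk with p prime. The absolute value is known, so only a sign ε is unknown.
Modulo p, Euler's criterion turns 2^((p-1)/2) into (2/p), and the congruence with the fixed field of
order 2^k gives (2/k) = ε (2/p). Since p > 2, this determines ε. -/
theorem goldSum_one {F : Type*} [Field F] [Algebra (ZMod 2) F] [Fintype F]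
    {m u : ℕ} (hF : Nat.card F = 2 ^ m) (hm : Odd m) (hum : Nat.Coprime u m) :
    goldSum F u 1 = jacobiSym 2 m * 2 ^ ((m + 1) / 2) := by
  induction m using Nat.strong_induction_on generalizing F with
  | _ m ih =>
  by_cases hm1 : m = 1
  · subst hm1
    have hc : Fintype.card F = 2 := by rw [← Nat.card_eq_fintype_card, hF, pow_one]
    classical
    have huniv : (Finset.univ : Finset F) = {0, 1} :=
      (Finset.eq_univ_of_card _ (by rw [Finset.card_pair zero_ne_one, hc])).symm
    rw [goldSum, huniv, Finset.sum_pair zero_ne_one]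
    simp [traceSign_zero, traceSign_one_add_one]
  · obtain ⟨k, hk⟩ := Nat.minFac_dvd m
    set p := m.minFac with hp
    have hpp : Fact p.Prime := ⟨Nat.minFac_prime hm1⟩
    have hodd := Nat.odd_mul.1 (hk ▸ hm)
    have hp2 : p ≠ 2 := fun h => by rw [h] at hodd; exact absurd hodd.1 (by decide)
    have hp3 : 2 < p := lt_of_le_of_ne hpp.out.two_le hp2.symm
    have hk0 : 0 < k := hodd.2.pos
    have hkm : k < m := by rw [hk]; nlinarith
    obtain ⟨E, hE, hmod⟩ := exists_goldSum_modEq u hp2 (hk ▸ hF)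
    have : Fintype E := Fintype.ofFinite E
    have hE1 := ih k hkm hE hodd.2 (Nat.Coprime.coprime_dvd_right ⟨p, by rw [mul_comm]; exact hk⟩ hum)
    have hmod := hmod this
    rw [hE1, ← ZMod.intCast_eq_intCast_iff] at hmod
    obtain ⟨ε, hε, hS⟩ : ∃ ε : ℤ, (ε = 1 ∨ ε = -1) ∧ goldSum F u 1 = ε * 2 ^ ((m + 1) / 2) := by
      rcases goldSum_one_eq_or hF hm hum with h | h
      · exact ⟨1, Or.inl rfl, by rw [h, one_mul]⟩
      · exact ⟨-1, Or.inr rfl, by rw [h]; ring⟩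
    -- As p is odd, `p / 2` is (p-1)/2, the exponent in Euler's criterion.
    have hexp : (m + 1) / 2 = (k + 1) / 2 + p / 2 * k := by
      obtain ⟨a, ha⟩ := hodd.1
      obtain ⟨b, hb⟩ := hodd.2
      have h1 : m + 1 = 2 * ((b + 1) + a * k) := by rw [hk, ha, hb]; ring
      have h2 : k + 1 = 2 * (b + 1) := by omega
      have h3 : p / 2 = a := by omega
      rw [h1, h2, h3, Nat.mul_div_cancel_left _ two_pos, Nat.mul_div_cancel_left _ two_pos]
    have hcop (n : ℕ) (hn : Odd n) : jacobiSym 2 n = 1 ∨ jacobiSym 2 n = -1 :=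
      jacobiSym.eq_one_or_neg_one (by
        rw [Int.gcd_eq_natAbs]; exact Nat.coprime_two_left.2 hn)
    have hlam := legendreSym.eq_pow p 2
    rw [jacobiSym.legendreSym.to_jacobiSym] at hlam
    -- A sign is unchanged by the odd power k.
    have hlk : jacobiSym 2 p ^ k = jacobiSym 2 p := by
      rcases hcop p hodd.1 with h | h <;> simp [h, hodd.2.neg_one_pow]
    have hll : jacobiSym 2 p * jacobiSym 2 p = 1 := by
      rcases hcop p hodd.1 with h | h <;> simp [h]
    have h2ne : (2 : ZMod p) ≠ 0 := by
      intro h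
      have := (ZMod.natCast_eq_zero_iff 2 p).1 (by exact_mod_cast h)
      exact absurd (Nat.le_of_dvd two_pos this) (by omega)
    have key : ((jacobiSym 2 k : ℤ) : ZMod p) = ((ε * jacobiSym 2 p : ℤ) : ZMod p) := by
      rw [hS, hexp, pow_add, pow_mul] at hmod
      push_cast at hmod hlam ⊢
      rw [← hlam] at hmod
      have hlk' := congrArg (Int.cast : ℤ → ZMod p) hlk
      push_cast at hlk'
      rw [hlk'] at hmod
      refine mul_right_cancel₀ (pow_ne_zero ((k + 1) / 2) h2ne) ?_
      rw [hmod]; ring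
    have hs := sign_eq_of_modEq hp3 (hcop k hodd.2) (by
      rcases hε with rfl | rfl <;> rcases hcop p hodd.1 with h | h <;> simp [h]) key
    have : NeZero k := ⟨hk0.ne'⟩
    have hj : jacobiSym 2 m = jacobiSym 2 p * jacobiSym 2 k := by
      conv_lhs => rw [hk]
      exact jacobiSym.mul_right _ _ _
    rw [hS, hj, hs]
    linear_combination (-ε * 2 ^ ((m + 1) / 2)) * hll

theorem jacobiSym_two_eq_of_even {m : ℕ} (hm : Odd m) (h : Even ((m ^ 2 - 1) / 8)) :
    jacobiSym 2 m = 1 := by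
  rw [jacobiSym.at_two hm, ZMod.χ₈_nat_eq_if_mod_eight]
  obtain ⟨c, hc⟩ := h
  have h2 := Nat.odd_iff.1 hm
  have h8 : m % 8 = 1 ∨ m % 8 = 3 ∨ m % 8 = 5 ∨ m % 8 = 7 := by omega
  have hdiv := Nat.div_add_mod m 8
  set a := m / 8
  rcases h8 with h | h | h | h
  · simp [h2, h]
  · have : m ^ 2 = 8 * (8 * a ^ 2 + 6 * a + 1) + 1 := by rw [← hdiv, h]; ring
    omega
  · have : m ^ 2 = 8 * (8 * a ^ 2 + 10 * a + 3) + 1 := by rw [← hdiv, h]; ring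
    omega
  · simp [h2, h]

theorem jacobiSym_two_eq_of_odd {m : ℕ} (hm : Odd m) (h : Odd ((m ^ 2 - 1) / 8)) :
    jacobiSym 2 m = -1 := by
  rw [jacobiSym.at_two hm, ZMod.χ₈_nat_eq_if_mod_eight]
  obtain ⟨c, hc⟩ := h
  have h2 := Nat.odd_iff.1 hm
  have h8 : m % 8 = 1 ∨ m % 8 = 3 ∨ m % 8 = 5 ∨ m % 8 = 7 := by omega
  have hdiv := Nat.div_add_mod m 8
  set a := m / 8
  rcases h8 with h | h | h | h
  · have : m ^ 2 = 8 * (8 * a ^ 2 + 2 * a) + 1 := by rw [← hdiv, h]; ring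
    omega
  · simp [h2, h]
  · simp [h2, h]
  · have : m ^ 2 = 8 * (8 * a ^ 2 + 14 * a + 6) + 1 := by rw [← hdiv, h]; ring
    omega

/-- The only use of the condition on ρ: it makes the Walsh term in the count of the defining set
positive. -/
theorem sgn_mul_jacobiSym_two {m : ℕ} (hm : Odd m) {ρ : ZMod 2}
    (hρ : (Even ((m ^ 2 - 1) / 8) ∧ ρ = 1) ∨ (Odd ((m ^ 2 - 1) / 8) ∧ ρ = 0)) :
    sgn ρ * jacobiSym 2 m = -1 := by
  rcases hρ with ⟨h, rfl⟩ | ⟨h, rfl⟩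
  · rw [jacobiSym_two_eq_of_even hm h]; rfl
  · rw [jacobiSym_two_eq_of_odd hm h]; rfl

/-! ### Character sums over the defining set. -/

section DefiningSet

variable {F : Type*} [Field F] [Algebra (ZMod 2) F]

theorem four_mul_indicator (a b ρ : ZMod 2) :
    (1 - sgn a) * (1 + sgn ρ * sgn b) = if a = 1 ∧ b = ρ then 4 else 0 := by
  revert a b ρ; decide

/-- Four times the indicator of the set is (1 - χ(x))(1 + sgn(ρ) χ(x^(2^u+1))). The factor χ(x)
shifts b to b + 1, which yields the four terms. -/
theorem four_mul_sum_definingSet [Fintype F] [DecidableEq F] (u : ℕ) (ρ : ZMod 2) {n : ℕ}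
    (d : Fin n → F) (hd : Function.Injective d) (hD : Set.range d = definingSet F u ρ) (b : F) :
    4 * ∑ i, traceSign (b * d i) =
      (if b = 0 then (Fintype.card F : ℤ) else 0) -
        (if b + 1 = 0 then (Fintype.card F : ℤ) else 0) +
        sgn ρ * (goldSum F u b - goldSum F u (b + 1)) := by
  classical
  have h1 : ∑ i, traceSign (b * d i) = ∑ x ∈ Finset.univ.filter (fun x : F =>
      Algebra.trace (ZMod 2) F x = 1 ∧ Algebra.trace (ZMod 2) F (x ^ (2 ^ u + 1)) = ρ),
      traceSign (b * x) := by
    refine (Finset.sum_map Finset.univ ⟨d, hd⟩ fun x => traceSign (b * x)).symm.trans ?_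
    congr 1
    ext x
    have : x ∈ Set.range d ↔ Algebra.trace (ZMod 2) F x = 1 ∧
        Algebra.trace (ZMod 2) F (x ^ (2 ^ u + 1)) = ρ := by rw [hD]; exact Iff.rfl
    simpa using this
  rw [h1, Finset.sum_filter, Finset.mul_sum, ← sum_traceSign_mul, ← sum_traceSign_mul, goldSum,
    goldSum, ← Finset.sum_sub_distrib, ← Finset.sum_sub_distrib, Finset.mul_sum,
    ← Finset.sum_add_distrib]
  refine Finset.sum_congr rfl fun x _ => ?_
  have h2 := four_mul_indicator (Algebra.trace (ZMod 2) F x)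
    (Algebra.trace (ZMod 2) F (x ^ (2 ^ u + 1))) ρ
  change (1 - traceSign x) * (1 + sgn ρ * traceSign (x ^ (2 ^ u + 1))) = _ at h2
  have h3 : (4 * if Algebra.trace (ZMod 2) F x = 1 ∧
      Algebra.trace (ZMod 2) F (x ^ (2 ^ u + 1)) = ρ then traceSign (b * x) else 0) =
      (if Algebra.trace (ZMod 2) F x = 1 ∧
      Algebra.trace (ZMod 2) F (x ^ (2 ^ u + 1)) = ρ then 4 else 0) * traceSign (b * x) := by
    split_ifs <;> ring
  rw [h3, ← h2, add_mul b, one_mul]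
  simp only [traceSign_add]
  ring

theorem traceSign_definingSet {n u : ℕ} {ρ : ZMod 2} {d : Fin n → F}
    (hD : Set.range d = definingSet F u ρ) (i : Fin n) :
    traceSign (d i) = -1 := by
  have : d i ∈ definingSet F u ρ := hD ▸ Set.mem_range_self i
  rw [traceSign, this.1, sgn_one]

variable [Fintype F] {m t u n : ℕ} {ρ : ZMod 2} {d : Fin n → F}

theorem goldSum_eq_zero (hF : Nat.card F = 2 ^ m) (hm : Odd m)
    (hum : Nat.Coprime u m) {b : F} (hb : traceSign b = 1) : goldSum F u b = 0 := by
  have h := goldSum_sq hF hm hum b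
  rw [traceSign_add, hb, traceSign_one hF hm] at h
  simpa using h

theorem goldSum_sq_eq_of_traceSign (hF : Nat.card F = 2 ^ m) (hm : Odd m)
    (hum : Nat.Coprime u m) {b : F} (hb : traceSign b = -1) : goldSum F u b ^ 2 = 2 ^ (m + 1) := by
  rw [goldSum_sq hF hm hum, traceSign_add, hb, traceSign_one hF hm, pow_succ]
  norm_num

theorem card_definingSet (ht : m = 2 * t + 3) (hF : Nat.card F = 2 ^ m)
    (hum : Nat.Coprime u m)
    (hρ : (Even ((m ^ 2 - 1) / 8) ∧ ρ = 1) ∨ (Odd ((m ^ 2 - 1) / 8) ∧ ρ = 0))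
    (hd : Function.Injective d) (hD : Set.range d = definingSet F u ρ) :
    n = 2 * (2 ^ t) ^ 2 + 2 ^ t := by
  classical
  have hm : Odd m := ⟨t + 1, by omega⟩
  have h := four_mul_sum_definingSet u ρ d hd hD 0
  have he : (m + 1) / 2 = t + 2 := by omega
  rw [zero_add, goldSum_eq_zero hF hm hum traceSign_zero, goldSum_one hF hm hum, he,
    ← Nat.card_eq_fintype_card, hF] at h
  have hj := sgn_mul_jacobiSym_two hm hρ
  simp only [zero_mul, traceSign_zero, Finset.sum_const, Finset.card_univ, Fintype.card_fin,
    if_true, one_ne_zero, if_false] at h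
  zify
  have h8 : (2 : ℤ) ^ m = 8 * (2 ^ t) ^ 2 := by rw [ht]; ring
  push_cast [h8] at h
  rw [pow_add] at h
  simp only [nsmul_eq_mul, mul_one] at h
  linarith [show sgn ρ * (0 - jacobiSym 2 m * (2 ^ t * 2 ^ 2)) = 4 * 2 ^ t by
    linear_combination (-4 * 2 ^ t) * hj]

theorem sum_traceSign_definingSet (ht : m = 2 * t + 3) (hF : Nat.card F = 2 ^ m)
    (hum : Nat.Coprime u m) (hd : Function.Injective d) (hD : Set.range d = definingSet F u ρ)
    {b : F} (hb0 : b ≠ 0) (hb1 : b ≠ 1) :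
    ∑ i, traceSign (b * d i) = 2 ^ t ∨ ∑ i, traceSign (b * d i) = -2 ^ t := by
  classical
  have := charP_two_of_algebra F
  have hm : Odd m := ⟨t + 1, by omega⟩
  have h := four_mul_sum_definingSet u ρ d hd hD b
  rw [if_neg hb0, if_neg fun h => hb1 (CharTwo.add_eq_zero.1 h)] at h
  have h16 : (2 : ℤ) ^ (m + 1) = 16 * (2 ^ t) ^ 2 := by rw [ht]; ring
  have hs : sgn ρ ^ 2 = 1 := by rcases sgn_eq_one_or ρ with h | h <;> simp [h]
  -- Since Tr 1 = 1, exactly one of b and b + 1 has trace 1, and only that Walsh sum survives.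
  have hW : (goldSum F u b - goldSum F u (b + 1)) ^ 2 = 16 * (2 ^ t) ^ 2 := by
    rcases traceSign_eq_one_or b with hb | hb
    · rw [goldSum_eq_zero hF hm hum hb, zero_sub, neg_sq, goldSum_sq_eq_of_traceSign hF hm hum, h16]
      rw [traceSign_add, hb, traceSign_one hF hm, one_mul]
    · rw [goldSum_eq_zero hF hm hum (b := b + 1), sub_zero, goldSum_sq_eq_of_traceSign hF hm hum hb,
        h16]
      rw [traceSign_add, hb, traceSign_one hF hm]; rfl
  rw [← sq_eq_sq_iff_eq_or_eq_neg]
  have h2 := congrArg (· ^ 2) h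
  simp only [sub_zero, zero_add, mul_pow, hs, hW] at h2
  linarith

end DefiningSet

/-! ### Character sums over the parameters of a given weight. -/

/-- The points `d i` of a finite field of order `8 q ^ 2` lie in the hyperplane complement
`Tr x = 1` and all their nontrivial character sums are `± q`. -/
structure IsTwoWeightSet {F : Type*} [Field F] [Algebra (ZMod 2) F] [Fintype F] {n : ℕ}
    (d : Fin n → F) (q : ℕ) : Prop where
  traceSign_eq : ∀ i, traceSign (d i) = -1
  injective : Function.Injective d
  sum_eq : ∀ b : F, b ≠ 0 → b ≠ 1 →
    ∑ i, traceSign (b * d i) = q ∨ ∑ i, traceSign (b * d i) = -q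
  card_index : n = 2 * q ^ 2 + q
  card_field : Fintype.card F = 8 * q ^ 2
  two_le : 2 ≤ q

section TwoWeight

variable {F : Type*} [Field F] [Algebra (ZMod 2) F] {n : ℕ} {d : Fin n → F} {q : ℕ}

/-- The support of the codeword attached to `b`. -/
noncomputable def traceSupport (d : Fin n → F) (b : F) : Finset (Fin n) :=
  Finset.univ.filter fun i => traceSign (b * d i) = -1

theorem mem_traceSupport {b : F} {i : Fin n} :
    i ∈ traceSupport d b ↔ traceSign (b * d i) = -1 := by
  simp [traceSupport]

theorem sum_traceSign_eq_sub (d : Fin n → F) (b : F) :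
    ∑ i, traceSign (b * d i) = n - 2 * ((traceSupport d b).card : ℤ) := by
  rw [traceSupport, Finset.card_filter, Nat.cast_sum, Finset.mul_sum]
  have : (n : ℤ) = ∑ _i : Fin n, 1 := by simp
  rw [this, ← Finset.sum_sub_distrib]
  refine Finset.sum_congr rfl fun i _ => ?_
  rcases traceSign_eq_one_or (b * d i) with h | h <;> simp [h]

variable [Fintype F] [DecidableEq F]

/-- The nontrivial `b` whose character sum is `s`. -/
noncomputable def sumClass (d : Fin n → F) (s : ℤ) : Finset F :=
  Finset.univ.filter fun b => b ≠ 0 ∧ b ≠ 1 ∧ ∑ i, traceSign (b * d i) = s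

theorem sum_traceSign_mul' (x : F) :
    ∑ b : F, traceSign (b * x) = if x = 0 then (Fintype.card F : ℤ) else 0 := by
  simp_rw [mul_comm _ x]
  exact sum_traceSign_mul x

namespace IsTwoWeightSet

variable (h : IsTwoWeightSet d q)
include h

omit [DecidableEq F] in
theorem ne_zero (i : Fin n) : d i ≠ 0 := by
  intro hi
  have := h.traceSign_eq i
  rw [hi, traceSign_zero] at this
  norm_num at this

omit [DecidableEq F] in
theorem add_ne_zero {i j : Fin n} (hij : i ≠ j) : d i + d j ≠ 0 := by
  have := charP_two_of_algebra F
  exact fun h0 => hij (h.injective (CharTwo.add_eq_zero.1 h0))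

-- The sum has trace 1 + 1 + 1 = 1. This is what allows pairs of coordinates, and not only single
-- ones, to be treated uniformly.
omit [DecidableEq F] in
theorem add_add_ne_zero (i j k : Fin n) : d k + d i + d j ≠ 0 := by
  intro h0
  have := congrArg traceSign h0
  simp only [traceSign_add, h.traceSign_eq, traceSign_zero] at this
  norm_num at this

omit [DecidableEq F] in
theorem sum_one : ∑ i, traceSign (1 * d i) = -n := by
  simp [h.traceSign_eq]

omit [DecidableEq F] in
theorem card_index_int : (n : ℤ) = 2 * q ^ 2 + q := by exact_mod_cast h.card_index

omit [DecidableEq F] in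
theorem card_field_int : (Fintype.card F : ℤ) = 8 * q ^ 2 := by exact_mod_cast h.card_field

/-- With S(b) the character sum at b, q + σ S(b) is 2q on the class S = σq and 0 on the other class.
The exceptional values S(0) = n and S(1) = -n are subtracted. -/
theorem two_mul_sum_sumClass {σ : ℤ} (hσ : σ = 1 ∨ σ = -1) (g : F → ℤ) :
    2 * q * ∑ b ∈ sumClass d (σ * q), g b =
      ∑ b, (q + σ * ∑ i, traceSign (b * d i)) * g b - (q + σ * n) * g 0 - (q - σ * n) * g 1 := by
  have key (b : F) : (q + σ * ∑ i, traceSign (b * d i)) * g b =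
      2 * q * (if b ≠ 0 ∧ b ≠ 1 ∧ ∑ i, traceSign (b * d i) = σ * q then g b else 0) +
      (if b = 0 then (q + σ * n) * g 0 else 0) + (if b = 1 then (q - σ * n) * g 1 else 0) := by
    by_cases h0 : b = 0
    · simp [h0, traceSign_zero]
    by_cases h1 : b = 1
    · rw [h1, h.sum_one]
      simp only [ne_eq, one_ne_zero, not_false_eq_true, not_true_eq_false, false_and, and_false,
        if_false, if_true]
      ring
    have hq : (q : ℤ) ≠ 0 := by have := h.two_le; positivity
    have hqq : (q : ℤ) ≠ -q := by omega
    have hqq' : -(q : ℤ) ≠ q := by omega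
    rcases hσ with rfl | rfl <;> rcases h.sum_eq b h0 h1 with hb | hb <;>
      simp only [h0, h1, hb, hqq, hqq', ne_eq, not_false_eq_true, true_and, one_mul, neg_one_mul,
        neg_neg, if_true, if_false] <;> ring
  rw [Finset.sum_congr rfl fun b _ => key b, Finset.sum_add_distrib, Finset.sum_add_distrib,
    ← Finset.mul_sum, ← Finset.sum_filter, Finset.sum_ite_eq', Finset.sum_ite_eq']
  simp only [sumClass, Finset.mem_univ, if_true]
  ring

theorem sum_univ (g : F → ℤ) :
    ∑ b, g b = g 0 + g 1 + ∑ b ∈ sumClass d q, g b + ∑ b ∈ sumClass d (-q), g b := by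
  have hq : (2 * q : ℤ) ≠ 0 := by have := h.two_le; positivity
  refine mul_left_cancel₀ hq ?_
  have h1 := h.two_mul_sum_sumClass (Or.inl rfl) g
  have h2 := h.two_mul_sum_sumClass (Or.inr rfl) g
  rw [one_mul] at h1
  rw [neg_one_mul] at h2
  rw [mul_add, mul_add, h1, h2]
  have h3 : ∑ b, (q + 1 * ∑ i, traceSign (b * d i)) * g b +
      ∑ b, (q + -1 * ∑ i, traceSign (b * d i)) * g b = 2 * q * ∑ b, g b := by
    rw [← Finset.sum_add_distrib, Finset.mul_sum]
    exact Finset.sum_congr rfl fun b _ => by ring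
  linear_combination -h3

-- By orthogonality the sum is |F| times the number of k with d_k = x. It is used for x = 0 and x =
-- d_i + d_j.
omit h in
theorem sum_index_mul_eq_zero {x : F} (hx : ∀ k, d k + x ≠ 0) :
    ∑ b, (∑ k, traceSign (b * d k)) * traceSign (b * x) = 0 := by
  simp_rw [Finset.sum_mul, ← traceSign_add, ← mul_add]
  rw [Finset.sum_comm]
  exact Finset.sum_eq_zero fun k _ => by rw [sum_traceSign_mul', if_neg (hx k)]

theorem card_sumClass {σ : ℤ} (hσ : σ = 1 ∨ σ = -1) :
    ((sumClass d (σ * q)).card : ℤ) = 4 * q ^ 2 - 1 := by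
  have hq : (2 * q : ℤ) ≠ 0 := by have := h.two_le; positivity
  refine mul_left_cancel₀ hq ?_
  have h1 := h.two_mul_sum_sumClass hσ fun _ => 1
  have h0 := sum_index_mul_eq_zero (d := d) (x := 0) fun k => by simpa using h.ne_zero k
  simp only [mul_zero, traceSign_zero, mul_one] at h0
  simp only [mul_one, Finset.sum_add_distrib, ← Finset.mul_sum, h0, Finset.sum_const,
    Finset.card_univ, nsmul_eq_mul, h.card_field_int] at h1
  rw [h1]; ring

theorem sum_sumClass_traceSign {σ : ℤ} (hσ : σ = 1 ∨ σ = -1) (i : Fin n) :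
    ∑ b ∈ sumClass d (σ * q), traceSign (b * d i) = σ * (2 * q - 1) := by
  have := charP_two_of_algebra F
  have hq : (2 * q : ℤ) ≠ 0 := by have := h.two_le; positivity
  refine mul_left_cancel₀ hq ?_
  rw [h.two_mul_sum_sumClass hσ fun b => traceSign (b * d i)]
  have h0 : ∑ b, (∑ k, traceSign (b * d k)) * traceSign (b * d i) = 8 * q ^ 2 := by
    simp_rw [Finset.sum_mul, ← traceSign_add, ← mul_add]
    rw [Finset.sum_comm, Finset.sum_eq_single i]
    · rw [sum_traceSign_mul', if_pos (CharTwo.add_self_eq_zero _), h.card_field_int]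
    · exact fun k _ hk => by rw [sum_traceSign_mul', if_neg (h.add_ne_zero hk)]
    · simp
  simp only [add_mul, mul_assoc, Finset.sum_add_distrib, ← Finset.mul_sum, h0]
  rw [sum_traceSign_mul', if_neg (h.ne_zero i), zero_mul, traceSign_zero, one_mul,
    h.traceSign_eq, h.card_index_int]
  ring

theorem sum_sumClass_traceSign_mul {σ : ℤ} (hσ : σ = 1 ∨ σ = -1) {i j : Fin n} (hij : i ≠ j) :
    ∑ b ∈ sumClass d (σ * q), traceSign (b * d i) * traceSign (b * d j) = -1 := by
  have hq : (2 * q : ℤ) ≠ 0 := by have := h.two_le; positivity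
  refine mul_left_cancel₀ hq ?_
  simp_rw [← traceSign_add, ← mul_add]
  rw [h.two_mul_sum_sumClass hσ fun b => traceSign (b * (d i + d j))]
  have h0 := sum_index_mul_eq_zero (d := d) (x := d i + d j) fun k => by
    rw [← add_assoc]; exact h.add_add_ne_zero i j k
  simp only [add_mul, mul_assoc, Finset.sum_add_distrib, ← Finset.mul_sum, h0]
  rw [sum_traceSign_mul', if_neg (h.add_ne_zero hij), zero_mul, traceSign_zero, one_mul,
    traceSign_add, h.traceSign_eq, h.traceSign_eq]
  ring

-- Interpolation on {0, 1, 2}: the size of the intersection is read off from two signs, so any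
-- function of it is a combination of 1, the two signs and their product.
omit h [Fintype F] [DecidableEq F] in
theorem four_mul_apply_card_inter (φ : ℕ → ℤ) (b : F) {i j : Fin n} (hij : i ≠ j) :
    4 * φ ((({i, j} : Finset (Fin n)) ∩ traceSupport d b).card) =
      φ 0 * ((1 + traceSign (b * d i)) * (1 + traceSign (b * d j))) +
      2 * φ 1 * (1 - traceSign (b * d i) * traceSign (b * d j)) +
      φ 2 * ((1 - traceSign (b * d i)) * (1 - traceSign (b * d j))) := by
  have hc : (({i, j} : Finset (Fin n)) ∩ traceSupport d b).card =
      (if traceSign (b * d i) = -1 then 1 else 0) +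
        if traceSign (b * d j) = -1 then 1 else 0 := by
    have : ({i, j} : Finset (Fin n)) ∩ traceSupport d b =
        ({i, j} : Finset (Fin n)).filter fun i => traceSign (b * d i) = -1 := by
      ext; simp [mem_traceSupport]
    rw [this, Finset.card_filter, Finset.sum_pair hij]
  rw [hc]
  rcases traceSign_eq_one_or (b * d i) with hi | hi <;>
    rcases traceSign_eq_one_or (b * d j) with hj | hj <;> simp [hi, hj] <;> ring

theorem four_mul_sum_sumClass {σ : ℤ} (hσ : σ = 1 ∨ σ = -1) (φ : ℕ → ℤ)
    {T : Finset (Fin n)} (hT : T.card = 2) :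
    4 * ∑ b ∈ sumClass d (σ * q), φ ((T ∩ traceSupport d b).card) =
      φ 0 * (4 * q ^ 2 - 2 + 2 * σ * (2 * q - 1)) + 2 * φ 1 * (4 * q ^ 2) +
        φ 2 * (4 * q ^ 2 - 2 - 2 * σ * (2 * q - 1)) := by
  obtain ⟨i, j, hij, rfl⟩ := Finset.card_eq_two.1 hT
  rw [Finset.mul_sum]
  simp_rw [four_mul_apply_card_inter φ _ hij]
  have h1 := h.card_sumClass hσ
  have hi := h.sum_sumClass_traceSign hσ i
  have hj := h.sum_sumClass_traceSign hσ j
  have h2 := h.sum_sumClass_traceSign_mul hσ hij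
  simp only [Finset.sum_add_distrib, ← Finset.mul_sum, mul_sub, sub_mul, mul_add, add_mul, one_mul,
    mul_one, Finset.sum_sub_distrib, Finset.sum_const, nsmul_eq_mul, h1, hi, hj, h2]
  ring

end IsTwoWeightSet

end TwoWeight

/-! ### The designs held by the trace code. -/

section CodeSupports

variable {F : Type*} [Field F] [Algebra (ZMod 2) F] {n : ℕ} {d : Fin n → F} {q : ℕ}

theorem card_wordSupport {K ι : Type*} [Field K] [DecidableEq K] [Fintype ι] (c : ι → K) :
    (wordSupport c).card = hammingNorm c := rfl

theorem wordSupport_trace (d : Fin n → F) (b : F) :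
    wordSupport (fun i => Algebra.trace (ZMod 2) F (b * d i)) = traceSupport d b := by
  have h : ∀ a : ZMod 2, a ≠ 0 ↔ sgn a = -1 := by decide
  ext i
  simp only [wordSupport, Finset.mem_filter, Finset.mem_univ, true_and, mem_traceSupport]
  exact h _

theorem mem_supportBlocks_traceCode {w : ℕ} {B : Finset (Fin n)} :
    B ∈ supportBlocks (traceCode d) w ↔
      ∃ b : F, (traceSupport d b).card = w ∧ traceSupport d b = B := by
  constructor
  · rintro ⟨c, ⟨b, rfl⟩, hw, rfl⟩
    exact ⟨b, by rw [← wordSupport_trace, card_wordSupport, hw], (wordSupport_trace d b).symm⟩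
  · rintro ⟨b, hw, rfl⟩
    refine ⟨_, ⟨b, rfl⟩, ?_, wordSupport_trace d b⟩
    rw [← card_wordSupport, wordSupport_trace, hw]

theorem traceSign_mul_eq_of_traceSupport_eq {b c : F} (hbc : traceSupport d b = traceSupport d c)
    (i : Fin n) : traceSign (b * d i) = traceSign (c * d i) := by
  have hi : traceSign (b * d i) = -1 ↔ traceSign (c * d i) = -1 := by
    rw [← mem_traceSupport, hbc, mem_traceSupport]
  rcases traceSign_eq_one_or (b * d i) with h | h
  · rcases traceSign_eq_one_or (c * d i) with h' | h'
    · rw [h, h']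
    · rw [h', hi.2 h']
  · rw [h, hi.1 h]

namespace IsTwoWeightSet

variable [Fintype F] (h : IsTwoWeightSet d q)
include h

/-- Equal supports make the character sum at b + c equal to n, whereas for b + c ≠ 0 it is -n or ±q.
Counting blocks therefore amounts to counting parameters b. -/
theorem traceSupport_injective : Function.Injective (traceSupport d) := by
  have := charP_two_of_algebra F
  intro b c hbc
  by_contra hne
  have hsum : ∑ i, traceSign ((b + c) * d i) = n := by
    have hi (i : Fin n) : traceSign ((b + c) * d i) = 1 := by
      rw [add_mul, traceSign_add, traceSign_mul_eq_of_traceSupport_eq hbc, traceSign_mul_self]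
    simp [hi]
  have h2 := h.two_le
  have hn := h.card_index_int
  have h0 : b + c ≠ 0 := fun h0 => hne (CharTwo.add_eq_zero.1 h0)
  have hq : (2 : ℤ) ≤ q := by exact_mod_cast h2
  by_cases h1 : b + c = 1
  · rw [h1, h.sum_one] at hsum
    nlinarith
  · rcases h.sum_eq _ h0 h1 with h3 | h3 <;> rw [h3] at hsum <;> nlinarith

variable [DecidableEq F]

theorem mem_sumClass {σ : ℤ} (hσ : σ = 1 ∨ σ = -1) {w : ℕ} (hw : (n : ℤ) - 2 * w = σ * q) (b : F) :
    b ∈ sumClass d (σ * q) ↔ (traceSupport d b).card = w := by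
  have hq : (2 : ℤ) ≤ q := by exact_mod_cast h.two_le
  have hn := h.card_index_int
  have hs := sum_traceSign_eq_sub d b
  simp only [sumClass, Finset.mem_filter, Finset.mem_univ, true_and]
  constructor
  · rintro ⟨-, -, hb⟩
    omega
  · intro hb
    rw [hb, hw] at hs
    refine ⟨?_, ?_, hs⟩
    · rintro rfl
      simp only [zero_mul, traceSign_zero, Finset.sum_const, Finset.card_univ, Fintype.card_fin,
        nsmul_eq_mul, mul_one] at hs
      rcases hσ with rfl | rfl <;> nlinarith
    · rintro rfl
      rw [h.sum_one] at hs
      rcases hσ with rfl | rfl <;> nlinarith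

theorem holdsDesign_traceCode {σ : ℤ} (hσ : σ = 1 ∨ σ = -1) {w l : ℕ}
    (hw : (n : ℤ) - 2 * w = σ * q) (hw2 : 2 ≤ w) (hwn : w ≤ n) (hl : 0 < l)
    (hlσ : 4 * (l : ℤ) = 4 * q ^ 2 - 2 - 2 * σ * (2 * q - 1)) :
    HoldsDesign (traceCode d) 2 n w l where
  one_le_t := one_le_two
  t_le_k := hw2
  k_le_v := hwn
  l_pos := hl
  card_points := Fintype.card_fin n
  card_block := by
    intro B hB
    obtain ⟨b, hb, rfl⟩ := mem_supportBlocks_traceCode.1 hB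
    exact hb
  card_blocks_containing := by
    intro T hT
    have hset : {B ∈ supportBlocks (traceCode d) w | T ⊆ B} =
        traceSupport d '' ((sumClass d (σ * q)).filter fun b => (T ∩ traceSupport d b).card = 2 :
          Finset F) := by
      ext B
      simp only [Set.mem_ofPred_eq, mem_supportBlocks_traceCode, Set.mem_image, Finset.coe_filter,
        h.mem_sumClass hσ hw]
      have hsub (b : F) : T ⊆ traceSupport d b ↔ (T ∩ traceSupport d b).card = 2 := by
        rw [← Finset.inter_eq_left, ← hT]
        exact ⟨fun h => by rw [h], fun h => Finset.eq_of_subset_of_card_le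
          Finset.inter_subset_left h.ge⟩
      constructor
      · rintro ⟨⟨b, hb, rfl⟩, hTb⟩
        exact ⟨b, ⟨hb, (hsub b).1 hTb⟩, rfl⟩
      · rintro ⟨b, ⟨hb, hTb⟩, rfl⟩
        exact ⟨⟨b, hb, rfl⟩, (hsub b).2 hTb⟩
    rw [hset, Set.ncard_image_of_injective _ h.traceSupport_injective, Set.ncard_coe_finset]
    -- The indicator of the value 2 selects the supports that contain the pair T.
    have h4 := h.four_mul_sum_sumClass hσ (fun a => if a = 2 then 1 else 0) hT
    rw [← Finset.sum_filter, Finset.sum_const, nsmul_eq_mul, mul_one] at h4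
    norm_num at h4
    exact Nat.cast_injective (R := ℤ) (by linarith)

end IsTwoWeightSet

end CodeSupports

/-! ### Dual codewords as zero-sum sets, and their generating polynomials. -/

open Polynomial in
/-- The generating polynomial of the products of `± 1`s over the sets containing a fixed set of
size `t`, when there are `n` signs, `w` of them negative, and `a` of the fixed ones negative. -/
noncomputable def signPoly (n t w a : ℕ) : ℤ[X] :=
  (-X) ^ a * X ^ (t - a) * ((1 - X) ^ (w - a) * (1 + X) ^ ((n - t) - (w - a)))

open Polynomial in
theorem sum_powersetCard_prod_eq_coeff {n : ℕ} (e : Fin n → ℤ) (he : ∀ i, e i = 1 ∨ e i = -1)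
    (k : ℕ) (T : Finset (Fin n)) :
    ∑ S ∈ (Finset.powersetCard k Finset.univ).filter (fun S => T ⊆ S), ∏ i ∈ S, e i =
      (signPoly n T.card (Finset.univ.filter fun i => e i = -1).card
        (T ∩ Finset.univ.filter fun i => e i = -1).card).coeff k := by
  set N := Finset.univ.filter fun i => e i = -1 with hN
  -- The constant term 0 at i ∈ T forces i into S when the product is expanded over subsets S.
  have h1 : ∏ i : Fin n, (C (e i) * X + if i ∈ T then 0 else 1) =
      signPoly n T.card N.card (T ∩ N).card := by
    have hpt (i : Fin n) : (C (e i) * X + if i ∈ T then 0 else 1 : ℤ[X]) =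
        if i ∈ T then (if i ∈ N then -X else X) else (if i ∈ N then 1 - X else 1 + X) := by
      rcases he i with h | h <;> by_cases hT : i ∈ T <;> simp [hN, h, hT] <;> ring
    rw [Finset.prod_congr rfl fun i _ => hpt i, Finset.prod_ite, Finset.prod_ite, Finset.prod_ite,
      signPoly]
    simp only [Finset.prod_const, Finset.filter_filter]
    have c1 : (Finset.univ.filter fun i => i ∈ T ∧ i ∈ N) = T ∩ N := by ext; simp
    have c2 : (Finset.univ.filter fun i => i ∈ T ∧ i ∉ N) = T \ N := by ext; simp
    have c3 : (Finset.univ.filter fun i => i ∉ T ∧ i ∈ N) = N \ T := by ext; simp [and_comm]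
    have c4 : (Finset.univ.filter fun i => i ∉ T ∧ i ∉ N) = Tᶜ \ (N \ T) := by
      ext; simp
      tauto
    have hsub : N \ T ⊆ Tᶜ := fun i hi => by simpa using (Finset.mem_sdiff.1 hi).2
    rw [c1, c2, c3, c4, Finset.card_sdiff_of_subset hsub, Finset.card_compl, Fintype.card_fin,
      Finset.card_sdiff (s := T), Finset.card_sdiff (s := N), Finset.inter_comm N T]
  rw [← h1, Finset.prod_add, finsetSum_coeff, Finset.sum_filter,
    ← Finset.sum_filter_add_sum_filter_not (Finset.powerset Finset.univ)
      fun S : Finset (Fin n) => S.card = k]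
  have hterm (S : Finset (Fin n)) :
      ((∏ i ∈ S, C (e i) * X) * ∏ i ∈ Finset.univ \ S, if i ∈ T then (0 : ℤ[X]) else 1) =
        C (if T ⊆ S then ∏ i ∈ S, e i else 0) * X ^ S.card := by
    have h2 : (∏ i ∈ Finset.univ \ S, if i ∈ T then (0 : ℤ[X]) else 1) =
        if T ⊆ S then 1 else 0 := by
      split_ifs with hTS
      · refine Finset.prod_eq_one fun i hi => if_neg fun hiT => ?_
        exact (Finset.mem_sdiff.1 hi).2 (hTS hiT)
      · obtain ⟨i, hiT, hiS⟩ := Finset.not_subset.1 hTS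
        exact Finset.prod_eq_zero (Finset.mem_sdiff.2 ⟨Finset.mem_univ i, hiS⟩) (if_pos hiT)
    rw [h2, Finset.prod_mul_distrib, Finset.prod_const, ← map_prod]
    split_ifs <;> simp
  have hp : Finset.filter (fun S : Finset (Fin n) => S.card = k) (Finset.powerset Finset.univ) =
      Finset.powersetCard k Finset.univ := by
    ext S; simp [Finset.mem_powersetCard]
  rw [hp]
  refine (add_zero _).symm.trans (congrArg₂ (· + ·) (Finset.sum_congr rfl fun S hS => ?_)
    (Finset.sum_eq_zero fun S hS => ?_).symm)
  · rw [hterm, coeff_C_mul, coeff_X_pow, if_pos (Finset.mem_powersetCard.1 hS).2.symm, mul_one]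
  · rw [hterm, coeff_C_mul, coeff_X_pow, if_neg (Ne.symm (Finset.mem_filter.1 hS).2), mul_zero]

section DualCode

variable {F : Type*} [Field F] [Algebra (ZMod 2) F] {n : ℕ} {d : Fin n → F}

theorem sum_mul_eq_sum_wordSupport (c : Fin n → ZMod 2) (b : F) :
    ∑ i, c i * Algebra.trace (ZMod 2) F (b * d i) =
      Algebra.trace (ZMod 2) F (b * ∑ i ∈ wordSupport c, d i) := by
  have h : ∀ a : ZMod 2, a ≠ 0 → a = 1 := by decide
  rw [Finset.mul_sum, map_sum, wordSupport, Finset.sum_filter]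
  refine Finset.sum_congr rfl fun i _ => ?_
  by_cases hc : c i = 0
  · simp [hc]
  · simp [h _ hc]

theorem mem_dualCode_traceCode [Finite F] {c : Fin n → ZMod 2} :
    c ∈ dualCode (traceCode d) ↔ ∑ i ∈ wordSupport c, d i = 0 := by
  constructor
  · intro hc
    by_contra hne
    obtain ⟨y, hy⟩ := exists_traceSign_mul_eq_neg_one hne
    have h0 := hc _ ⟨y, rfl⟩
    rw [sum_mul_eq_sum_wordSupport, mul_comm] at h0
    rw [traceSign, h0, sgn_zero] at hy
    norm_num at hy
  · rintro h0 _ ⟨b, rfl⟩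
    rw [sum_mul_eq_sum_wordSupport, h0, mul_zero, map_zero]

theorem wordSupport_injective {ι : Type*} [Fintype ι] :
    Function.Injective (wordSupport : (ι → ZMod 2) → Finset ι) := by
  have h : ∀ a b : ZMod 2, (a ≠ 0 ↔ b ≠ 0) → a = b := by decide
  intro c c' hcc
  ext1 i
  refine h _ _ ?_
  have := Finset.ext_iff.1 hcc i
  simpa [wordSupport] using this

theorem exists_wordSupport_eq {ι : Type*} [Fintype ι] [DecidableEq ι] (S : Finset ι) :
    ∃ c : ι → ZMod 2, wordSupport c = S :=
  ⟨fun i => if i ∈ S then 1 else 0, by ext i; simp [wordSupport]⟩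

variable [DecidableEq F]

/-- The sets of `k` indices containing `T` along which the points `d i` sum to zero. -/
def zeroSumSets (d : Fin n → F) (k : ℕ) (T : Finset (Fin n)) : Finset (Finset (Fin n)) :=
  (Finset.powersetCard k Finset.univ).filter fun S => T ⊆ S ∧ ∑ i ∈ S, d i = 0

omit [Algebra (ZMod 2) F] in
theorem mem_zeroSumSets {k : ℕ} {T S : Finset (Fin n)} :
    S ∈ zeroSumSets d k T ↔ S.card = k ∧ T ⊆ S ∧ ∑ i ∈ S, d i = 0 := by
  simp [zeroSumSets, Finset.mem_powersetCard]

theorem supportBlocks_dualCode [Finite F] (k : ℕ) :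
    supportBlocks (dualCode (traceCode d)) k = zeroSumSets d k ∅ := by
  ext S
  rw [Finset.mem_coe, mem_zeroSumSets]
  constructor
  · rintro ⟨c, hc, hk, rfl⟩
    exact ⟨hk, Finset.empty_subset _, mem_dualCode_traceCode.1 hc⟩
  · rintro ⟨hk, -, h0⟩
    obtain ⟨c, rfl⟩ := exists_wordSupport_eq S
    exact ⟨c, mem_dualCode_traceCode.2 h0, hk, rfl⟩

theorem weightCount_dualCode [Finite F] (k : ℕ) :
    weightCount (dualCode (traceCode d)) k = (zeroSumSets d k ∅).card := by
  rw [← Set.ncard_coe_finset, ← supportBlocks_dualCode, weightCount,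
    ← Set.ncard_image_of_injective _ wordSupport_injective]
  congr 1
  ext S
  simp [supportBlocks, and_assoc]

theorem ncard_supportBlocks_dualCode [Finite F] (k : ℕ) (T : Finset (Fin n)) :
    {B ∈ supportBlocks (dualCode (traceCode d)) k | T ⊆ B}.ncard = (zeroSumSets d k T).card := by
  rw [← Set.ncard_coe_finset, supportBlocks_dualCode]
  congr 1
  ext S
  simp only [Set.mem_ofPred_eq, Finset.mem_coe, mem_zeroSumSets, Finset.empty_subset, true_and]
  tauto

/-- Orthogonality detects the zero-sum condition. Exchanging the sums leaves, for each b, a sum of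
products of signs over the k-sets containing T, which depends only on the weight of b and its
overlap with T. -/
theorem card_field_mul_card_zeroSumSets [Fintype F] (k : ℕ) (T : Finset (Fin n)) :
    (Fintype.card F : ℤ) * (zeroSumSets d k T).card =
      ∑ b : F, (signPoly n T.card (traceSupport d b).card (T ∩ traceSupport d b).card).coeff k := by
  have h1 (b : F) := sum_powersetCard_prod_eq_coeff (fun i => traceSign (b * d i))
    (fun i => traceSign_eq_one_or _) k T
  simp only [traceSupport, ← h1]
  rw [Finset.sum_comm]
  have h2 (S : Finset (Fin n)) : ∑ b : F, ∏ i ∈ S, traceSign (b * d i) =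
      if ∑ i ∈ S, d i = 0 then (Fintype.card F : ℤ) else 0 := by
    simp_rw [← traceSign_sum, ← Finset.mul_sum]
    exact sum_traceSign_mul' _
  rw [Finset.sum_congr rfl fun S _ => h2 S, ← Finset.sum_filter, Finset.filter_filter,
    Finset.sum_const, nsmul_eq_mul, mul_comm]
  rfl

-- Double counting of the pairs T ⊆ S; it yields λ once the summands are known to be equal.
omit [Algebra (ZMod 2) F] in
theorem sum_card_zeroSumSets (k t : ℕ) :
    ∑ T ∈ Finset.powersetCard t Finset.univ, (zeroSumSets d k T).card =
      (zeroSumSets d k ∅).card * k.choose t := by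
  have h := Finset.sum_card_bipartiteAbove_eq_sum_card_bipartiteBelow
    (s := Finset.powersetCard t (Finset.univ : Finset (Fin n))) (t := zeroSumSets d k ∅)
    (fun T S => T ⊆ S)
  have h1 (T : Finset (Fin n)) : zeroSumSets d k T =
      (zeroSumSets d k ∅).bipartiteAbove (fun T S => T ⊆ S) T := by
    ext S
    simp only [Finset.mem_bipartiteAbove, mem_zeroSumSets, Finset.empty_subset, true_and]
    tauto
  rw [Finset.sum_congr rfl fun T _ => congrArg Finset.card (h1 T), h, ← smul_eq_mul,
    ← Finset.sum_const]
  refine Finset.sum_congr rfl fun S hS => ?_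
  rw [← (mem_zeroSumSets.1 hS).1, ← Finset.card_powersetCard]
  congr 1
  ext T
  simp [Finset.mem_bipartiteBelow, Finset.mem_powersetCard, and_comm]

end DualCode

-- The polynomial equals (1 - X²)^N (1 + X)^(2k), and the even coefficients of the second factor are
-- the binomials with even lower index.
open Polynomial in
theorem coeff_two_mul_one_sub_mul_one_add (N k r : ℕ) :
    ((1 - X : ℤ[X]) ^ N * (1 + X) ^ (N + 2 * k)).coeff (2 * r) =
      ∑ p ∈ (Finset.Icc 0 N ×ˢ Finset.Icc 0 k).filter (fun p : ℕ × ℕ => p.1 + p.2 = r),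
        (-1) ^ p.1 * (N.choose p.1 : ℤ) * ((2 * k).choose (2 * p.2) : ℤ) := by
  have h1 : (1 - X : ℤ[X]) ^ N * (1 + X) ^ (N + 2 * k) =
      ∑ i ∈ Finset.Icc 0 N, C ((-1) ^ i * (N.choose i : ℤ)) * (X ^ (2 * i) * (1 + X) ^ (2 * k)) := by
    have h2 : (1 - X : ℤ[X]) ^ N * (1 + X) ^ (N + 2 * k) =
        (-X ^ 2 + 1) ^ N * (1 + X) ^ (2 * k) := by
      rw [pow_add, ← mul_assoc, ← mul_pow]; ring
    rw [h2, add_pow, Finset.sum_mul, ← Nat.range_succ_eq_Icc_zero]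
    refine Finset.sum_congr rfl fun i _ => ?_
    rw [one_pow, mul_one, neg_pow, ← pow_mul]
    simp
    ring
  rw [h1, finsetSum_coeff, Finset.sum_filter, Finset.sum_product]
  refine Finset.sum_congr rfl fun i _ => ?_
  rw [coeff_C_mul, coeff_X_pow_mul', coeff_one_add_X_pow, ← Finset.sum_filter]
  by_cases hir : i ≤ r
  · rw [if_pos (by omega)]
    by_cases hk : r - i ≤ k
    · rw [show (Finset.Icc 0 k).filter (fun j => i + j = r) = {r - i} by ext j; simp; omega,
        Finset.sum_singleton, Nat.mul_sub]
    · rw [show (Finset.Icc 0 k).filter (fun j => i + j = r) = ∅ by ext j; simp; omega,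
        Finset.sum_empty, Nat.choose_eq_zero_of_lt (show 2 * k < 2 * r - 2 * i by omega)]
      simp
  · rw [if_neg (by omega), show (Finset.Icc 0 k).filter (fun j => i + j = r) = ∅ by
      ext j; simp; omega]
    simp

theorem signPoly_zero_zero (n w : ℕ) :
    signPoly n 0 w 0 = (1 - Polynomial.X) ^ w * (1 + Polynomial.X) ^ (n - w) := by
  simp [signPoly]

-- Complementing the signs substitutes -X for X, which leaves even coefficients unchanged.
open Polynomial in
theorem coeff_signPoly_compl {n w k : ℕ} (hw : w ≤ n) (hk : Even k) :
    (signPoly n 0 (n - w) 0).coeff k = (signPoly n 0 w 0).coeff k := by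
  have h : signPoly n 0 (n - w) 0 = (signPoly n 0 w 0).comp (C (-1) * X) := by
    rw [signPoly_zero_zero, signPoly_zero_zero, Nat.sub_sub_self hw]
    simp [sub_eq_add_neg]
    ring
  rw [h, comp_C_mul_X_coeff, hk.neg_one_pow, mul_one]

/-! ### Weight distribution and designs of the dual code. -/

namespace IsTwoWeightSet

variable {F : Type*} [Field F] [Algebra (ZMod 2) F] [Fintype F] [DecidableEq F] {n : ℕ}
  {d : Fin n → F} {q : ℕ} (h : IsTwoWeightSet d q)
include h

theorem card_traceSupport_of_mem_pos {b : F} (hb : b ∈ sumClass d q) :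
    (traceSupport d b).card = q ^ 2 := by
  rw [← one_mul (q : ℤ)] at hb
  exact (h.mem_sumClass (Or.inl rfl) (by rw [h.card_index]; push_cast; ring) b).1 hb

theorem card_traceSupport_of_mem_neg {b : F} (hb : b ∈ sumClass d (-q)) :
    (traceSupport d b).card = q ^ 2 + q := by
  rw [← neg_one_mul (q : ℤ)] at hb
  exact (h.mem_sumClass (Or.inr rfl) (by rw [h.card_index]; push_cast; ring) b).1 hb

omit h [Fintype F] [DecidableEq F] in
theorem traceSupport_zero : traceSupport d 0 = ∅ := by
  ext i; simp [mem_traceSupport, traceSign_zero]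

omit [DecidableEq F] in
theorem traceSupport_one : traceSupport d 1 = Finset.univ := by
  ext i; simp [mem_traceSupport, h.traceSign_eq]

/-- Within each weight class the summand is a function of the overlap with the pair, and
`four_mul_sum_sumClass` shows that its sum is the same for all pairs. The terms b = 0 and b = 1 have
empty and full support. -/
theorem card_zeroSumSets_eq_of_card_two (k : ℕ) {T T' : Finset (Fin n)} (hT : T.card = 2)
    (hT' : T'.card = 2) : (zeroSumSets d k T).card = (zeroSumSets d k T').card := by
  have hF : (Fintype.card F : ℤ) ≠ 0 := by exact_mod_cast Fintype.card_ne_zero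
  refine Nat.cast_injective (R := ℤ) (mul_left_cancel₀ hF ?_)
  have hclass {σ : ℤ} (hσ : σ = 1 ∨ σ = -1) {w : ℕ}
      (hw : ∀ b ∈ sumClass d (σ * q), (traceSupport d b).card = w) :
      ∑ b ∈ sumClass d (σ * q),
        (signPoly n 2 (traceSupport d b).card (T ∩ traceSupport d b).card).coeff k =
      ∑ b ∈ sumClass d (σ * q),
        (signPoly n 2 (traceSupport d b).card (T' ∩ traceSupport d b).card).coeff k := by
    have hw' (T : Finset (Fin n)) := Finset.sum_congr rfl fun b hb =>
      congrArg (fun w => (signPoly n 2 w (T ∩ traceSupport d b).card).coeff k) (hw b hb)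
    rw [hw', hw']
    refine mul_left_cancel₀ four_ne_zero ?_
    rw [h.four_mul_sum_sumClass hσ (fun a => (signPoly n 2 w a).coeff k) hT,
      h.four_mul_sum_sumClass hσ (fun a => (signPoly n 2 w a).coeff k) hT']
  have h1 := hclass (Or.inl rfl) (w := q ^ 2) fun b hb =>
    h.card_traceSupport_of_mem_pos (by rwa [one_mul] at hb)
  have h2 := hclass (Or.inr rfl) (w := q ^ 2 + q) fun b hb =>
    h.card_traceSupport_of_mem_neg (by rwa [neg_one_mul] at hb)
  rw [one_mul] at h1
  rw [neg_one_mul] at h2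
  rw [card_field_mul_card_zeroSumSets, card_field_mul_card_zeroSumSets, h.sum_univ,
    h.sum_univ (fun b => (signPoly n T'.card _ (T' ∩ traceSupport d b).card).coeff k), hT, hT', h1,
    h2, traceSupport_zero, h.traceSupport_one, Finset.inter_empty, Finset.inter_empty,
    Finset.inter_univ, Finset.inter_univ, hT, hT']

/-- For even k, complementary weights contribute equally. So 0 pairs with n and q² with q² + q, and
|F| = 8q² is halved to 4q². -/
theorem card_field_mul_card_zeroSumSets_empty {k : ℕ} (hk : Even k) :
    4 * (q : ℤ) ^ 2 * (zeroSumSets d k ∅).card = n.choose k +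
      (4 * q ^ 2 - 1) *
        ((1 - Polynomial.X : Polynomial ℤ) ^ q ^ 2 * (1 + Polynomial.X) ^ (q ^ 2 + q)).coeff k := by
  have hA := card_field_mul_card_zeroSumSets (d := d) k ∅
  have hn := h.card_index
  have e1 : q ^ 2 + q = n - q ^ 2 := by omega
  have hc1 := h.card_sumClass (Or.inl rfl)
  have hc2 := h.card_sumClass (Or.inr rfl)
  rw [one_mul] at hc1
  rw [neg_one_mul] at hc2
  have h0 : (signPoly n 0 0 0).coeff k = n.choose k := by
    rw [signPoly_zero_zero, pow_zero, one_mul, Nat.sub_zero, Polynomial.coeff_one_add_X_pow]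
  have hn0 : (signPoly n 0 n 0).coeff k = n.choose k := by
    rw [← h0, ← coeff_signPoly_compl n.zero_le hk, Nat.sub_zero]
  rw [h.sum_univ] at hA
  simp only [Finset.card_empty, Finset.empty_inter, traceSupport_zero, h.traceSupport_one,
    Finset.card_univ, Fintype.card_fin, h0, hn0] at hA
  rw [Finset.sum_congr rfl fun b hb => by rw [h.card_traceSupport_of_mem_pos hb],
    Finset.sum_congr (s₁ := sumClass d (-q)) rfl fun b hb => by
      rw [h.card_traceSupport_of_mem_neg hb, e1, coeff_signPoly_compl (by omega) hk],
    Finset.sum_const, Finset.sum_const, nsmul_eq_mul, nsmul_eq_mul, hc1, hc2,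
    h.card_field_int, signPoly_zero_zero, ← e1] at hA
  linarith

theorem holdsDesign_dualCode {k : ℕ} (hk : 2 ≤ k)
    (hpos : 0 < weightCount (dualCode (traceCode d)) k) :
    ∃ l : ℕ, l * n.choose 2 = weightCount (dualCode (traceCode d)) k * k.choose 2 ∧
      HoldsDesign (dualCode (traceCode d)) 2 n k l := by
  rw [weightCount_dualCode] at hpos ⊢
  obtain ⟨S, hS⟩ := Finset.card_pos.1 hpos
  have hSk := (mem_zeroSumSets.1 hS).1
  -- The reference pair is taken inside an existing block, so that λ > 0.
  obtain ⟨T₀, hT₀S, hT₀⟩ := Finset.exists_subset_card_eq (hSk ▸ hk)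
  refine ⟨(zeroSumSets d k T₀).card, ?_, ?_⟩
  · rw [← sum_card_zeroSumSets, Finset.sum_congr rfl fun T hT =>
      h.card_zeroSumSets_eq_of_card_two k (Finset.mem_powersetCard.1 hT).2 hT₀, Finset.sum_const,
      Finset.card_powersetCard, Finset.card_univ, Fintype.card_fin, smul_eq_mul, mul_comm]
  · refine ⟨one_le_two, hk, ?_, ?_, Fintype.card_fin n, ?_, ?_⟩
    · rw [← hSk]; exact card_finset_fin_le S
    · exact Finset.card_pos.2 ⟨S, mem_zeroSumSets.2 ⟨hSk, hT₀S, (mem_zeroSumSets.1 hS).2.2⟩⟩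
    · intro B hB
      rw [supportBlocks_dualCode] at hB
      exact (mem_zeroSumSets.1 hB).1
    · intro T hT
      rw [ncard_supportBlocks_dualCode, h.card_zeroSumSets_eq_of_card_two k hT hT₀]

end IsTwoWeightSet

/-! ### Application to the defining set and conclusion. -/

theorem isTwoWeightSet_definingSet {F : Type*} [Field F] [Algebra (ZMod 2) F] [Fintype F]
    {m t u n : ℕ} {ρ : ZMod 2} {d : Fin n → F} (ht : m = 2 * t + 3) (ht0 : 0 < t)
    (hF : Nat.card F = 2 ^ m) (hum : Nat.Coprime u m)
    (hρ : (Even ((m ^ 2 - 1) / 8) ∧ ρ = 1) ∨ (Odd ((m ^ 2 - 1) / 8) ∧ ρ = 0))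
    (hd : Function.Injective d) (hD : Set.range d = definingSet F u ρ) :
    IsTwoWeightSet d (2 ^ t) where
  traceSign_eq := traceSign_definingSet hD
  injective := hd
  sum_eq b hb0 hb1 := by
    have := sum_traceSign_definingSet ht hF hum hd hD hb0 hb1
    exact_mod_cast this
  card_index := card_definingSet ht hF hum hρ hd hD
  card_field := by rw [← Nat.card_eq_fintype_card, hF, ht]; ring
  two_le := Nat.le_self_pow ht0.ne' 2

theorem mainTheorem6 (m u : ℕ) (hm : 5 ≤ m) (hm_odd : Odd m) (hu : 0 < u)
    (hum : Nat.gcd u m = 1)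
    (F : Type*) [Field F] [Finite F] [Algebra (ZMod 2) F] (hF : Nat.card F = 2 ^ m)
    (ρ : ZMod 2)
    (hρ : (Even ((m ^ 2 - 1) / 8) ∧ ρ = 1) ∨ (Odd ((m ^ 2 - 1) / 8) ∧ ρ = 0))
    (n : ℕ) (d : Fin n → F) (hd : Function.Injective d)
    (hD : Set.range d = definingSet F u ρ) :
    (HoldsDesign (traceCode d) 2 (2 ^ (m - 2) + 2 ^ ((m - 3) / 2)) (2 ^ (m - 3))
        (2 ^ (m - 3) - 2 ^ ((m - 3) / 2)) ∧
      HoldsDesign (traceCode d) 2 (2 ^ (m - 2) + 2 ^ ((m - 3) / 2))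
        (2 ^ (m - 3) + 2 ^ ((m - 3) / 2)) (2 ^ (m - 3) + 2 ^ ((m - 3) / 2) - 1)) ∧
    ∀ r : ℕ, 2 ≤ r → r ≤ 2 ^ (m - 3) + 2 ^ ((m - 5) / 2) →
      (weightCount (dualCode (traceCode d)) (2 * r) : ℚ) =
          1 / 2 ^ (m - 1) *
            (((2 ^ (m - 2) + 2 ^ ((m - 3) / 2)).choose (2 * r) : ℚ) +
              (2 ^ (m - 1) - 1) *
                ∑ p ∈ (Finset.Icc 0 (2 ^ (m - 3)) ×ˢ Finset.Icc 0 (2 ^ ((m - 5) / 2))).filter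
                    (fun p : ℕ × ℕ => p.1 + p.2 = r),
                  (-1) ^ p.1 * ((2 ^ (m - 3)).choose p.1 : ℚ) *
                    ((2 ^ ((m - 3) / 2)).choose (2 * p.2) : ℚ)) ∧
      (0 < weightCount (dualCode (traceCode d)) (2 * r) →
        ∃ l : ℕ,
          (l : ℚ) =
            (2 * r) * (2 * r - 1) * (weightCount (dualCode (traceCode d)) (2 * r) : ℚ) /
              ((2 ^ (m - 2) + 2 ^ ((m - 3) / 2)) *
                (2 ^ (m - 2) + 2 ^ ((m - 3) / 2) - 1)) ∧
          HoldsDesign (dualCode (traceCode d)) 2 (2 ^ (m - 2) + 2 ^ ((m - 3) / 2)) (2 * r) l) := by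
  classical
  have : Fintype F := Fintype.ofFinite F
  -- All powers of 2 become expressions in q = 2^(s+1) and k = 2^s = q/2; m ≥ 5 ensures q ≥ 2.
  obtain ⟨s, hs⟩ : ∃ s, m = 2 * s + 5 := ⟨(m - 5) / 2, by obtain ⟨a, ha⟩ := hm_odd; omega⟩
  have h := isTwoWeightSet_definingSet (t := s + 1) (by omega) s.succ_pos hF hum hρ hd hD
  have e3 : (m - 3) / 2 = s + 1 := by omega
  have e5 : (m - 5) / 2 = s := by omega
  have q1 (R : Type) [CommSemiring R] : (2 : R) ^ (m - 1) = 4 * (2 ^ (s + 1)) ^ 2 := by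
    rw [show m - 1 = 2 + (s + 1) * 2 by omega, pow_add, pow_mul]; norm_num
  have q2 (R : Type) [CommSemiring R] : (2 : R) ^ (m - 2) = 2 * (2 ^ (s + 1)) ^ 2 := by
    rw [show m - 2 = 1 + (s + 1) * 2 by omega, pow_add, pow_mul]; norm_num
  have q3 : 2 ^ (m - 3) = (2 ^ (s + 1)) ^ 2 := by
    rw [← pow_mul]; congr 1; omega
  rw [e3, e5, q1, q2, q2, q3]
  have hk : 2 ^ (s + 1) = 2 * 2 ^ s := by ring
  have hq2 := h.two_le
  have hn := h.card_index
  generalize 2 ^ s = k at hk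
  rw [show (2 : ℚ) ^ (s + 1) = ((2 ^ (s + 1) : ℕ) : ℚ) by norm_cast]
  generalize 2 ^ (s + 1) = q at *
  rw [← hn]
  have hqq : 2 * q ≤ q ^ 2 := by rw [sq]; exact Nat.mul_le_mul_right q hq2
  refine ⟨⟨?_, ?_⟩, fun r hr hr' => ⟨?_, fun hpos => ?_⟩⟩
  · refine h.holdsDesign_traceCode (Or.inl rfl) ?_ (by omega) (by omega) (by omega) ?_
    · rw [hn]; push_cast; ring
    · rw [Nat.cast_sub (by omega)]; push_cast; ring
  · refine h.holdsDesign_traceCode (Or.inr rfl) ?_ (by omega) (by omega) (by omega) ?_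
    · rw [hn]; push_cast; ring
    · rw [Nat.cast_sub (by omega)]; push_cast; ring
  · have hA := h.card_field_mul_card_zeroSumSets_empty (even_two_mul r)
    -- The fifth q is the linear one in the exponent q² + q; writing it as 2k gives the shape N + 2k
    -- with N = q².
    nth_rw 5 [hk] at hA
    rw [coeff_two_mul_one_sub_mul_one_add, ← hk] at hA
    have hA' := congrArg (Int.cast : ℤ → ℚ) hA
    push_cast at hA'
    rw [weightCount_dualCode, ← hA']
    have : (q : ℚ) ≠ 0 := by positivity
    field_simp
  · obtain ⟨l, hl, hdes⟩ := h.holdsDesign_dualCode (by omega) hpos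
    refine ⟨l, ?_, hdes⟩
    have hl' := congrArg (Nat.cast : ℕ → ℚ) hl
    rw [Nat.cast_mul, Nat.cast_mul, Nat.cast_choose_two, Nat.cast_choose_two] at hl'
    have hnq : (n : ℚ) = 2 * (q : ℚ) ^ 2 + q := by rw [hn]; push_cast; ring
    have hn2 : (2 : ℚ) ≤ n := by
      have : 2 ≤ n := by omega
      exact_mod_cast this
    rw [← hnq, eq_div_iff (mul_ne_zero (by linarith) (by linarith))]
    push_cast at hl'
    linarith
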